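/- Let $\mathfrak H$ and $\mathfrak H_n$ ($n\in\mathbb N$) be separable complex Hilbert spaces, and let $J_n\colon\mathfrak H\to\mathfrak H_n$ be bounded linear operators such that, for some constant $C>0$, $$\|J_n\|\le C\ \text{ for all } n,\qquad \|J_n^*J_n-\mathbb I\|\to 0,\qquad \|J_nJ_n^*-\mathbb I\|\to 0 .$$ Let $A$ and $A_n$ be (possibly unbounded) self-adjoint operators in $\mathfrak H$ and $\mathfrak H_n$, respectively, let $\Sigma=\overline{\sigma(A)\cup\bigcup_n\sigma(A_n)}$, and suppose that $A_n$ converges to $A$ in the generalized norm resolvent sense, that is, for some $z\in\mathbb C\setminus\Sigma$, $$\lim_{n\to\infty}\bigl\|J_n^*(A_n-z)^{-1}J_n-(A-z)^{-1}\bigr\|=0 .$$ For a self-adjoint operator $T$, let $\sigma_{ess}(T)$ denote the essential spectrum, i.e. the set of all points of $\sigma(T)$ that are not eigenvalues of finite multiplicity isolated in $\sigma(T)$. Then $$\sigma_{ess}(A)=\lim_{n\to\infty}\sigma_{ess}(A_n),$$ where the right-hand side denotes the set of all $\lambda\in\mathbb C$ for which there is a sequence $\lambda_n\to\lambda$ with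 $\lambda_n\in\sigma_{ess}(A_n)$ for all sufficiently large $n$. -/

import Mathlib

open Filter Topology

noncomputable section

namespace LinearPMap

section Spectrum

variable {H : Type*} [NormedAddCommGroup H] [InnerProductSpace ℂ H]

/-- The linear map `A - z : 𝔇(A) → H`. -/
def subScalar (A : H →ₗ.[ℂ] H) (z : ℂ) : A.domain →ₗ[ℂ] H :=
  A.toFun - z • A.domain.subtype

/-- `R` is a bounded, everywhere defined, two-sided inverse of `A - z : 𝔇(A) → H`. -/
def IsResolventAt (A : H →ₗ.[ℂ] H) (z : ℂ) (R : H →L[ℂ] H) : Prop :=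
  (∀ x : H, ∃ y : A.domain, R x = y ∧ A.subScalar z y = x) ∧
    ∀ y : A.domain, R (A.subScalar z y) = y

theorem IsResolventAt.unique {A : H →ₗ.[ℂ] H} {z : ℂ} {R S : H →L[ℂ] H}
    (hR : A.IsResolventAt z R) (hS : A.IsResolventAt z S) : R = S := by
  ext x
  obtain ⟨y, hy, hx⟩ := hR.1 x
  rw [hy, ← hx, hS.2 y]

/-- The resolvent set `ρ(A)`: all `z` for which `A - z : 𝔇(A) → H` is bijective with a bounded
inverse. -/
def resolventSet (A : H →ₗ.[ℂ] H) : Set ℂ :=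
  {z | ∃ R : H →L[ℂ] H, A.IsResolventAt z R}

/-- The spectrum `σ(A)`, the complement of the resolvent set. -/
def spectrum (A : H →ₗ.[ℂ] H) : Set ℂ :=
  (A.resolventSet)ᶜ

open Classical in
/-- The resolvent `R_A(z) = (A - z)⁻¹` for `z ∈ ρ(A)` (and `0` for `z ∉ ρ(A)`). -/
def resolvent (A : H →ₗ.[ℂ] H) (z : ℂ) : H →L[ℂ] H :=
  if h : ∃ R : H →L[ℂ] H, A.IsResolventAt z R then h.choose else 0

theorem isResolventAt_resolvent {A : H →ₗ.[ℂ] H} {z : ℂ} (hz : z ∈ A.resolventSet) :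
    A.IsResolventAt z (A.resolvent z) := by
  have h : ∃ R : H →L[ℂ] H, A.IsResolventAt z R := hz
  unfold resolvent
  rw [dif_pos h]
  exact h.choose_spec

/-- The eigenspace `ker (A - z)`, as a subspace of the domain of `A`. -/
def eigenspace (A : H →ₗ.[ℂ] H) (z : ℂ) : Submodule ℂ A.domain :=
  LinearMap.ker (A.subScalar z)

/-- The discrete spectrum of a self-adjoint operator: the eigenvalues of finite multiplicity
that are isolated points of the spectrum. -/
def discreteSpectrum (A : H →ₗ.[ℂ] H) : Set ℂ :=
  {z | A.eigenspace z ≠ ⊥ ∧ FiniteDimensional ℂ (A.eigenspace z) ∧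
    ∃ ε : ℝ, 0 < ε ∧ ∀ w ∈ A.spectrum, dist w z < ε → w = z}

/-- The essential spectrum `σ_ess(A)` of a self-adjoint operator: the part of the spectrum that is
not discrete. -/
def essentialSpectrum (A : H →ₗ.[ℂ] H) : Set ℂ :=
  A.spectrum \ A.discreteSpectrum

end Spectrum

section Convergence

variable {H : Type*} [NormedAddCommGroup H] [InnerProductSpace ℂ H] [CompleteSpace H]
  {K : ℕ → Type*} [∀ n, NormedAddCommGroup (K n)] [∀ n, InnerProductSpace ℂ (K n)]
  [∀ n, CompleteSpace (K n)]

/-- The condition on the identification operators `Jₙ : H → Kₙ`: they are uniformly bounded and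
both `‖Jₙ* Jₙ - 1‖` and `‖Jₙ Jₙ* - 1‖` tend to zero. -/
def AsymptoticallyUnitary (J : ∀ n, H →L[ℂ] K n) : Prop :=
  (∃ C : ℝ, 0 < C ∧ ∀ n, ‖J n‖ ≤ C) ∧
    Tendsto (fun n => ‖(J n).adjoint ∘L J n - ContinuousLinearMap.id ℂ H‖) atTop (𝓝 0) ∧
    Tendsto (fun n => ‖J n ∘L (J n).adjoint - ContinuousLinearMap.id ℂ (K n)‖) atTop (𝓝 0)

/-- The set `Σ`, the closure of `σ(A) ∪ ⋃ₙ σ(Aₙ)`. -/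
def jointSpectrum (A : H →ₗ.[ℂ] H) (An : ∀ n, K n →ₗ.[ℂ] K n) : Set ℂ :=
  _root_.closure (A.spectrum ∪ ⋃ n, (An n).spectrum)

/-- Convergence of `Aₙ` to `A` in the generalized norm resolvent sense with respect to the
identification operators `Jₙ`: the `Jₙ` are asymptotically unitary and
`‖Jₙ* R_{Aₙ}(z) Jₙ - R_A(z)‖ → 0` for one `z ∈ ℂ \ Σ`. -/
def GenNormResolventConv (J : ∀ n, H →L[ℂ] K n) (An : ∀ n, K n →ₗ.[ℂ] K n)
    (A : H →ₗ.[ℂ] H) : Prop :=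
  AsymptoticallyUnitary J ∧
    ∃ z : ℂ, z ∉ jointSpectrum A An ∧
      Tendsto (fun n => ‖(J n).adjoint ∘L (An n).resolvent z ∘L J n - A.resolvent z‖)
        atTop (𝓝 0)

end Convergence

end LinearPMap

/-- The limit of a sequence of sets of complex numbers: all limits of sequences `lₙ` with
`lₙ ∈ Sₙ` for all sufficiently large `n`. -/
def setLimit (S : ℕ → Set ℂ) : Set ℂ :=
  {z | ∃ l : ℕ → ℂ, (∀ᶠ n in atTop, l n ∈ S n) ∧ Tendsto l atTop (𝓝 z)}

end

/-! Since `z` lies off `Σ`, the map `w ↦ (w - z)⁻¹` carries the essential spectra of `A` and `Aₙ` to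
the nonzero parts of those of their resolvents `R` and `Rₙ`, which are bounded and normal. It thus
suffices that the essential spectra of `Rₙ` and `R` are eventually within any given `r > 0` of each
other.

For a normal operator, essential spectrum near `μ` is detected by an infinite-dimensional subspace
on which `T - μ` is small: the continuous functional calculus gives
`hasQuasimodes_of_mem_essentialSpectrum` and its quantitative converse
`HasQuasimodes.exists_mem_essentialSpectrum`. Such subspaces survive any map that is bounded below
and almost intertwines two operators. Both `Jₙ` and `Jₙ*` eventually do this for `R` and `Rₙ`, with
errors tending to zero. -/

noncomputable section

namespace ContinuousLinearMap

/-! ### Quasimodes and their transport. -/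

section Quasimodes

variable {H : Type*} [NormedAddCommGroup H] [InnerProductSpace ℂ H]

/-- The essential spectrum of a bounded operator `T`: the points of the spectrum which are not
isolated eigenvalues of finite multiplicity. -/
def essentialSpectrum (T : H →L[ℂ] H) : Set ℂ :=
  {μ | μ ∈ spectrum ℂ T ∧ ¬ (Module.End.eigenspace (T : H →ₗ[ℂ] H) μ ≠ ⊥ ∧
    FiniteDimensional ℂ (Module.End.eigenspace (T : H →ₗ[ℂ] H) μ) ∧
    ∀ᶠ w in 𝓝[≠] μ, w ∉ spectrum ℂ T)}

/-- There is an infinite-dimensional subspace on which `T - μ` is bounded by `c`. -/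
def HasQuasimodes (T : H →L[ℂ] H) (μ : ℂ) (c : ℝ) : Prop :=
  ∃ V : Submodule ℂ H, ¬ FiniteDimensional ℂ V ∧ ∀ x ∈ V, ‖T x - μ • x‖ ≤ c * ‖x‖

/-- Quasimodes are transported by an operator that is bounded below and almost intertwines. -/
theorem HasQuasimodes.map {K : Type*} [NormedAddCommGroup K] [InnerProductSpace ℂ K]
    {T : H →L[ℂ] H} {S : K →L[ℂ] K} {X : H →L[ℂ] K} {μ : ℂ} {c m δ : ℝ}
    (h : T.HasQuasimodes μ c) (hc : 0 ≤ c) (hδ : 0 ≤ δ) (hX : ∀ x, ‖x‖ ≤ m * ‖X x‖)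
    (hST : ‖X ∘L T - S ∘L X‖ ≤ δ) :
    S.HasQuasimodes μ ((‖X‖ * c + δ) * m) := by
  obtain ⟨V, hV, hVc⟩ := h
  have hinj : Function.Injective X := by
    refine (injective_iff_map_eq_zero X).2 fun x hx => ?_
    have := hX x
    rw [hx, norm_zero, mul_zero] at this
    exact norm_le_zero_iff.1 this
  refine ⟨V.map (X : H →ₗ[ℂ] K), fun hfin => hV ?_, ?_⟩
  · exact (Submodule.equivMapOfInjective (X : H →ₗ[ℂ] K) hinj V).symm.finiteDimensional
  · rintro _ ⟨x, hx, rfl⟩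
    have h1 : S (X x) - μ • X x = X (T x - μ • x) - (X ∘L T - S ∘L X) x := by
      simp
    calc ‖S (X x) - μ • X x‖ ≤ ‖X (T x - μ • x)‖ + ‖(X ∘L T - S ∘L X) x‖ := by
          rw [h1]; exact norm_sub_le _ _
      _ ≤ ‖X‖ * (c * ‖x‖) + δ * ‖x‖ := by
          gcongr
          · exact (X.le_opNorm _).trans (by gcongr; exact hVc x hx)
          · exact ContinuousLinearMap.le_of_opNorm_le _ hST x
      _ = (‖X‖ * c + δ) * ‖x‖ := by ring
      _ ≤ (‖X‖ * c + δ) * (m * ‖X x‖) := by gcongr; exact hX x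
      _ = _ := by simp [mul_assoc]

end Quasimodes

/-! ### Essential spectrum and quasimodes of bounded normal operators. -/

section Normal

variable {H : Type*} [NormedAddCommGroup H] [InnerProductSpace ℂ H] [CompleteSpace H]
  {T : H →L[ℂ] H}

/-- A spectral point outside the essential spectrum is isolated, so its other neighbours are not
even spectral. -/
theorem isClosed_essentialSpectrum (T : H →L[ℂ] H) : IsClosed T.essentialSpectrum := by
  rw [← isOpen_compl_iff, isOpen_iff_mem_nhds]
  intro μ hμ
  by_cases hσ : μ ∈ spectrum ℂ T
  · have hd : ∀ᶠ w in 𝓝[≠] μ, w ∉ spectrum ℂ T := by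
      by_contra h
      exact hμ ⟨hσ, fun h' => h h'.2.2⟩
    rw [eventually_nhdsWithin_iff] at hd
    filter_upwards [hd] with w hw
    by_cases hwμ : w = μ
    · exact hwμ ▸ hμ
    · exact fun h => hw hwμ h.1
  · filter_upwards [(spectrum.isClosed T).isOpen_compl.mem_nhds hσ] with w hw h
    exact hw h.1

theorem cfc_sub_smul_apply (hT : IsStarNormal T) {f h : ℂ → ℂ} {ν : ℂ}
    (hh : ContinuousOn h (spectrum ℂ T)) (hfh : ∀ w ∈ spectrum ℂ T, h w * (w - ν) = f w) (x : H) :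
    cfc h T (T x - ν • x) = cfc f T x := by
  have h1 : cfc f T = cfc h T * (T - algebraMap ℂ _ ν) := by
    rw [← cfc_congr (a := T) hfh, cfc_mul h (fun w => w - ν) T,
      cfc_sub (fun w : ℂ => w) (fun _ => ν) T, cfc_id' ℂ T, cfc_const ν T]
  rw [h1]
  simp [Algebra.algebraMap_eq_smul_one]

theorem sub_smul_cfc_apply (hT : IsStarNormal T) {f h : ℂ → ℂ} {ν : ℂ}
    (hh : ContinuousOn h (spectrum ℂ T)) (hfh : ∀ w ∈ spectrum ℂ T, h w * (w - ν) = f w) (x : H) :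
    T (cfc h T x) - ν • cfc h T x = cfc f T x := by
  have h1 : cfc f T = (T - algebraMap ℂ _ ν) * cfc h T := by
    rw [← cfc_congr (a := T) (fun w hw => (mul_comm (w - ν) (h w)).trans (hfh w hw)),
      cfc_mul (fun w => w - ν) h T,
      cfc_sub (fun w : ℂ => w) (fun _ => ν) T, cfc_id' ℂ T, cfc_const ν T]
  rw [h1]
  simp [Algebra.algebraMap_eq_smul_one]

/-- By normality the orthogonal complement of the range of `T - ν` is its kernel, so the lower bound
also yields dense range. -/
theorem notMem_spectrum_of_bounded_below (hT : IsStarNormal T) {ν : ℂ} {C : NNReal}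
    (h : ∀ x, ‖x‖ ≤ C * ‖T x - ν • x‖) : ν ∉ spectrum ℂ T := by
  have hS : ∀ x, (T - algebraMap ℂ (H →L[ℂ] H) ν) x = T x - ν • x := fun x => by
    simp [Algebra.algebraMap_eq_smul_one]
  have hN : IsStarNormal (T - algebraMap ℂ (H →L[ℂ] H) ν) := by
    rw [← cfc_id' ℂ T, ← cfc_const ν T, ← cfc_sub (fun w : ℂ => w) (fun _ => ν) T]
    exact cfc_predicate _ _
  have hb : Function.Bijective (T - algebraMap ℂ (H →L[ℂ] H) ν) := by
    rw [bijective_iff_dense_range_and_antilipschitz]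
    refine ⟨?_, C, AddMonoidHomClass.antilipschitz_of_bound _ fun x => by rw [hS]; exact h x⟩
    rw [Submodule.topologicalClosure_eq_top_iff, ContinuousLinearMap.IsStarNormal.orthogonal_range hN, LinearMap.ker_eq_bot']
    intro x hx
    have h1 := h x
    rw [← hS x] at h1
    have h2 : (T - algebraMap ℂ (H →L[ℂ] H) ν) x = 0 := hx
    rw [h2, norm_zero, mul_zero] at h1
    exact norm_le_zero_iff.1 h1
  rw [spectrum.mem_iff, not_not, ← IsUnit.neg_iff, neg_sub]
  exact isUnit_iff_bijective.2 hb

/-- Every function on a set is continuous at an isolated point of the set. -/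
theorem _root_.continuousWithinAt_of_eventually_notMem {f : ℂ → ℂ} {s : Set ℂ} {ν : ℂ}
    (h : ∀ᶠ w in 𝓝[≠] ν, w ∉ s) : ContinuousWithinAt f s ν := by
  have : 𝓝[s] ν ≤ pure ν := by
    rw [le_pure_iff, mem_nhdsWithin_iff_eventually]
    rw [eventually_nhdsWithin_iff] at h
    filter_upwards [h] with w hw hws
    by_contra hne
    exact hw hne hws
  exact (tendsto_pure_nhds f ν).mono_left this

/-- The indicator function of a point that is isolated in a set is continuous on this set. -/
theorem _root_.continuousOn_indicator_singleton {s : Set ℂ} {ν : ℂ}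
    (h : ∀ᶠ w in 𝓝[≠] ν, w ∉ s) :
    ContinuousOn (Set.indicator {ν} (fun _ => (1 : ℂ))) s := by
  intro w _
  by_cases hw : w = ν
  · subst hw
    exact continuousWithinAt_of_eventually_notMem h
  · refine ContinuousAt.continuousWithinAt ?_
    have : Set.indicator ({ν} : Set ℂ) (fun _ => (1 : ℂ)) =ᶠ[𝓝 w] fun _ => 0 := by
      filter_upwards [isOpen_ne.mem_nhds hw] with u hu
      exact Set.indicator_of_notMem (s := {ν}) hu _
    exact continuousAt_const.congr this.symm

/-- Quasimodes of a normal operator indicate a nearby point of the essential spectrum. -/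
theorem HasQuasimodes.exists_mem_essentialSpectrum (hT : IsStarNormal T) {μ : ℂ} {c r : ℝ}
    (h : T.HasQuasimodes μ c) (hcr : c < r) (hr : 0 < r) :
    ∃ ν ∈ T.essentialSpectrum, dist ν μ ≤ r := by
  by_contra! hcon
  set F : Set ℂ := spectrum ℂ T ∩ Metric.closedBall μ r
  have hdisc : ∀ ν ∈ F, Module.End.eigenspace (T : H →ₗ[ℂ] H) ν ≠ ⊥ ∧
      FiniteDimensional ℂ (Module.End.eigenspace (T : H →ₗ[ℂ] H) ν) ∧
      ∀ᶠ w in 𝓝[≠] ν, w ∉ spectrum ℂ T := by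
    intro ν hν
    by_contra h'
    exact absurd (hcon ν ⟨hν.1, h'⟩) (not_lt.2 hν.2)
  -- `F` is compact, and all its points are isolated.
  have hfin : F.Finite := by
    refine IsCompact.finite ((isCompact_closedBall μ r).inter_left (spectrum.isClosed T)) ?_
    rw [isDiscrete_iff_nhdsNE]
    intro ν hν
    rw [← disjoint_iff, Filter.disjoint_principal_right]
    filter_upwards [(hdisc ν hν).2.2] with w hw hwF
    exact hw hwF.1
  let e : ℂ → ℂ → ℂ := fun ν => Set.indicator {ν} (fun _ => (1 : ℂ))
  have hecont : ∀ ν ∈ hfin.toFinset, ContinuousOn (e ν) (spectrum ℂ T) := fun ν hν =>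
    continuousOn_indicator_singleton (hdisc ν (hfin.mem_toFinset.1 hν)).2.2
  let f : ℂ → ℂ := ∑ ν ∈ hfin.toFinset, e ν
  have hf1 : ∀ w ∈ F, f w = 1 := by
    intro w hw
    simp only [f, Finset.sum_apply]
    rw [Finset.sum_eq_single w]
    · simp [e]
    · intro b _ hb
      exact Set.indicator_of_notMem (fun h => hb h.symm) _
    · simp [hw]
  have hf0 : ∀ w ∉ F, f w = 0 := by
    intro w hw
    simp only [f, Finset.sum_apply]
    refine Finset.sum_eq_zero fun b hb => Set.indicator_of_notMem (fun h => hw ?_) _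
    rw [Set.mem_singleton_iff.1 h]
    exact hfin.mem_toFinset.1 hb
  have hfcont : ContinuousOn f (spectrum ℂ T) := by
    have : f = fun w => ∑ ν ∈ hfin.toFinset, e ν w := by ext; simp [f]
    rw [this]
    exact continuousOn_finsetSum _ hecont
  -- the spectral projection onto the ball has finite rank
  have hrange : FiniteDimensional ℂ (LinearMap.range ((cfc f T : H →L[ℂ] H) : H →ₗ[ℂ] H)) := by
    have hle : LinearMap.range ((cfc f T : H →L[ℂ] H) : H →ₗ[ℂ] H) ≤
        ⨆ ν : hfin.toFinset, Module.End.eigenspace (T : H →ₗ[ℂ] H) ν := by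
      rintro _ ⟨x, rfl⟩
      rw [show cfc f T = ∑ ν ∈ hfin.toFinset, cfc (e ν) T from cfc_sum e T _ hecont]
      simp only [coe_coe, sum_apply]
      refine Submodule.sum_mem _ fun ν hν => ?_
      refine Submodule.mem_iSup_of_mem (⟨ν, hν⟩ : hfin.toFinset) ?_
      rw [Module.End.mem_eigenspace_iff]
      have := sub_smul_cfc_apply hT (f := fun _ => 0) (h := e ν) (ν := ν) (hecont ν hν)
        (fun w _ => by
          by_cases hw : w = ν
          · simp [hw]
          · simp [e, hw]) x
      simpa [sub_eq_zero] using this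
    have : ∀ ν : hfin.toFinset,
        FiniteDimensional ℂ (Module.End.eigenspace (T : H →ₗ[ℂ] H) (ν : ℂ)) := fun ν =>
      (hdisc ν (hfin.mem_toFinset.1 ν.2)).2.1
    exact Submodule.finiteDimensional_of_le hle
  obtain ⟨V, hV, hVc⟩ := h
  -- Otherwise `cfc f T` would embed `V` into a finite-dimensional space.
  obtain ⟨x, hxV, hx0, hfx⟩ : ∃ x ∈ V, x ≠ 0 ∧ cfc f T x = 0 := by
    by_contra! hne
    refine hV ?_
    let g : V →ₗ[ℂ] LinearMap.range ((cfc f T : H →L[ℂ] H) : H →ₗ[ℂ] H) :=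
      ((cfc f T : H →L[ℂ] H) : H →ₗ[ℂ] H).rangeRestrict ∘ₗ V.subtype
    refine FiniteDimensional.of_injective g ((injective_iff_map_eq_zero g).2 fun v hv => ?_)
    by_contra hv0
    refine hne v v.2 (fun h => hv0 (Subtype.ext h)) ?_
    exact congrArg Subtype.val hv
  -- `k` inverts `w - μ` on the spectrum outside the ball and vanishes on `F`, hence `|k| ≤ 1/r`. If
  -- `μ` is spectral it is isolated, so the default value `0` there harms neither continuity nor `k
  -- w * (w - μ) = 1 - f w`.
  let k : ℂ → ℂ := fun w => (1 - f w) / (w - μ)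
  have hμ : μ ∈ spectrum ℂ T → μ ∈ F := fun h => ⟨h, Metric.mem_closedBall_self hr.le⟩
  have hkcont : ContinuousOn k (spectrum ℂ T) := by
    intro w hw
    by_cases hwμ : w = μ
    · subst hwμ
      exact continuousWithinAt_of_eventually_notMem (hdisc w (hμ hw)).2.2
    · exact (continuousWithinAt_const.sub (hfcont w hw)).div
        (continuousWithinAt_id.sub continuousWithinAt_const) (sub_ne_zero.2 hwμ)
  have hk : ∀ w ∈ spectrum ℂ T, k w * (w - μ) = 1 - f w := by
    intro w hw
    by_cases hwμ : w = μ
    · subst hwμ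
      simp [hf1 w (hμ hw)]
    · exact div_mul_cancel₀ _ (sub_ne_zero.2 hwμ)
  have hkn : ‖cfc k T‖ ≤ r⁻¹ := by
    refine norm_cfc_le (inv_nonneg.2 hr.le) fun w hw => ?_
    by_cases hwF : w ∈ F
    · simp [k, hf1 w hwF, hr.le]
    · have : r < ‖w - μ‖ := by
        rw [← dist_eq_norm]
        by_contra! hle
        exact hwF ⟨hw, hle⟩
      have hkw : k w = (w - μ)⁻¹ := by simp [k, hf0 w hwF]
      rw [hkw, norm_inv]
      gcongr
  have hkx := cfc_sub_smul_apply hT hkcont hk x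
  rw [cfc_sub (fun _ => 1) f T continuousOn_const hfcont, cfc_const_one ℂ T] at hkx
  simp only [sub_apply, one_apply_eq_self, hfx, sub_zero] at hkx
  have hxpos : 0 < ‖x‖ := norm_pos_iff.2 hx0
  have : ‖x‖ ≤ r⁻¹ * (c * ‖x‖) := by
    calc ‖x‖ = ‖cfc k T (T x - μ • x)‖ := by rw [hkx]
      _ ≤ r⁻¹ * ‖T x - μ • x‖ := le_of_opNorm_le _ hkn _
      _ ≤ _ := by gcongr; exact hVc x hxV
  rw [← div_eq_inv_mul, le_div_iff₀ hr] at this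
  nlinarith

/-- A continuous cutoff function, equal to `1` on the ball of radius `a` about `μ` and to `0`
outside the ball of radius `b`. -/
def _root_.radialCutoff (μ : ℂ) (a b : ℝ) (w : ℂ) : ℂ :=
  ((max 0 (min 1 ((b - dist w μ) / (b - a))) : ℝ) : ℂ)

theorem _root_.continuous_radialCutoff (μ : ℂ) (a b : ℝ) : Continuous (radialCutoff μ a b) := by
  unfold radialCutoff
  fun_prop

theorem _root_.radialCutoff_eq_one {μ w : ℂ} {a b : ℝ} (hab : a < b) (hw : dist w μ ≤ a) :
    radialCutoff μ a b w = 1 := by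
  have : 1 ≤ (b - dist w μ) / (b - a) := by
    rw [le_div_iff₀ (by linarith)]; linarith
  simp [radialCutoff, min_eq_left this]

theorem _root_.radialCutoff_eq_zero {μ w : ℂ} {a b : ℝ} (hab : a < b) (hw : b ≤ dist w μ) :
    radialCutoff μ a b w = 0 := by
  have : (b - dist w μ) / (b - a) ≤ 0 := div_nonpos_of_nonpos_of_nonneg (by linarith) (by linarith)
  simp [radialCutoff, max_eq_left ((min_le_right _ _).trans this)]

theorem _root_.norm_radialCutoff_le_one (μ w : ℂ) (a b : ℝ) : ‖radialCutoff μ a b w‖ ≤ 1 := by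
  rw [radialCutoff, Complex.norm_real, Real.norm_of_nonneg (le_max_left _ _)]
  exact max_le zero_le_one (min_le_left _ _)

/-- Points of the essential spectrum of a normal operator have arbitrarily good quasimodes. -/
theorem hasQuasimodes_of_mem_essentialSpectrum (hT : IsStarNormal T) {μ : ℂ}
    (hμ : μ ∈ T.essentialSpectrum) {ε : ℝ} (hε : 0 < ε) : T.HasQuasimodes μ ε := by
  by_contra hcon
  have hfinite : ∀ V : Submodule ℂ H, (∀ x ∈ V, ‖T x - μ • x‖ ≤ ε * ‖x‖) →
      FiniteDimensional ℂ V := fun V hV => by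
    by_contra h
    exact hcon ⟨V, h, hV⟩
  -- The radii are nested so that `g = 1` wherever `f ≠ 0`. Then `g(T)` fixes the range of `f(T)`,
  -- and `|g(w)(w - μ)| ≤ ε` bounds `T - μ` there; without quasimodes this range is
  -- finite-dimensional.
  let f := radialCutoff μ (ε / 3) (2 * ε / 3)
  let g := radialCutoff μ (2 * ε / 3) ε
  have hfc : Continuous f := continuous_radialCutoff _ _ _
  have hgc : Continuous g := continuous_radialCutoff _ _ _
  have hgf : cfc f T = cfc g T * cfc f T := by
    rw [← cfc_mul g f T hgc.continuousOn hfc.continuousOn]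
    refine cfc_congr fun w _ => ?_
    rcases le_total (dist w μ) (2 * ε / 3) with h | h
    · simp [g, radialCutoff_eq_one (show 2 * ε / 3 < ε by linarith) h]
    · simp [f, radialCutoff_eq_zero (show ε / 3 < 2 * ε / 3 by linarith) h]
  let V : Submodule ℂ H := LinearMap.range ((cfc f T : H →L[ℂ] H) : H →ₗ[ℂ] H)
  have hV : FiniteDimensional ℂ V := by
    refine hfinite V ?_
    rintro _ ⟨y, rfl⟩
    have hx : ((cfc f T : H →L[ℂ] H) : H →ₗ[ℂ] H) y = cfc g T (cfc f T y) :=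
      congrArg (fun S : H →L[ℂ] H => S y) hgf
    have h1 := sub_smul_cfc_apply hT (f := fun w => g w * (w - μ)) (ν := μ) hgc.continuousOn
      (fun w _ => rfl) (cfc f T y)
    rw [← hx] at h1
    rw [h1]
    refine le_of_opNorm_le (cfc (fun w => g w * (w - μ)) T) (norm_cfc_le hε.le fun w _ => ?_) _
    rw [norm_mul, ← dist_eq_norm]
    rcases le_total (dist w μ) ε with h | h
    · exact (mul_le_of_le_one_left dist_nonneg (norm_radialCutoff_le_one _ _ _ _)).trans h
    · simp [g, radialCutoff_eq_zero (show 2 * ε / 3 < ε by linarith) h, hε.le]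
  -- As `f = 1` near `ν`, the quotient `(1 - f w) / (w - ν)` vanishes near `ν` and is continuous; it
  -- inverts `T - ν` from the left modulo `f(T)`.
  have hbound : ∀ ν, dist ν μ < ε / 3 → ∃ S : H →L[ℂ] H, ∀ x, S (T x - ν • x) = x - cfc f T x := by
    intro ν hν
    let k : ℂ → ℂ := fun w => (1 - f w) / (w - ν)
    have hev : ∀ᶠ w in 𝓝 ν, f w = 1 := by
      filter_upwards [Metric.ball_mem_nhds ν (sub_pos.2 hν)] with w hw
      refine radialCutoff_eq_one (by linarith) ?_
      have := dist_triangle w ν μ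
      have := Metric.mem_ball.1 hw
      linarith
    have hk : Continuous k := by
      refine continuous_iff_continuousAt.2 fun w => ?_
      by_cases hw : w = ν
      · subst hw
        refine (continuousAt_const (y := (0 : ℂ))).congr ?_
        filter_upwards [hev] with u hu
        simp [k, hu]
      · exact (continuousAt_const.sub hfc.continuousAt).div
          (continuousAt_id.sub continuousAt_const) (sub_ne_zero.2 hw)
    refine ⟨cfc k T, fun x => ?_⟩
    rw [cfc_sub_smul_apply hT (f := fun w => 1 - f w) hk.continuousOn (fun w _ => ?_) x,
      cfc_sub (fun _ => 1) f T continuousOn_const hfc.continuousOn, cfc_const_one ℂ T]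
    · simp
    · by_cases hw : w = ν
      · subst hw
        simp [hev.self_of_nhds]
      · exact div_mul_cancel₀ _ (sub_ne_zero.2 hw)
  have hcomm : ∀ x, cfc f T (T x) = T (cfc f T x) := by
    intro x
    have h1 := cfc_sub_smul_apply hT (f := fun w => f w * (w - 0)) (ν := 0) hfc.continuousOn
      (fun w _ => rfl) x
    have h2 := sub_smul_cfc_apply hT (f := fun w => f w * (w - 0)) (ν := 0) hfc.continuousOn
      (fun w _ => rfl) x
    simp only [zero_smul, sub_zero] at h1 h2
    rw [h1, h2]
  have heigV : ∀ ν, dist ν μ < ε / 3 → Module.End.eigenspace (T : H →ₗ[ℂ] H) ν ≤ V := by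
    intro ν hν x hx
    obtain ⟨S, hS⟩ := hbound ν hν
    rw [Module.End.mem_eigenspace_iff, coe_coe] at hx
    have := hS x
    rw [hx, sub_self, map_zero, eq_comm, sub_eq_zero] at this
    exact ⟨x, this.symm⟩
  -- If `T - ν` were injective, it would be bounded below on the finite-dimensional `V`; `S`
  -- controls the remaining part `x - f(T) x`, so `T - ν` would be bounded below on all of `H`.
  have heig : ∀ ν ∈ spectrum ℂ T, dist ν μ < ε / 3 →
      Module.End.eigenspace (T : H →ₗ[ℂ] H) ν ≠ ⊥ := by
    intro ν hνσ hν hbot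
    obtain ⟨S, hS⟩ := hbound ν hν
    let L : V →ₗ[ℂ] H := ((T : H →ₗ[ℂ] H) - ν • LinearMap.id) ∘ₗ V.subtype
    have hL : LinearMap.ker L = ⊥ := by
      rw [LinearMap.ker_eq_bot']
      intro v hv
      have : (v : H) ∈ Module.End.eigenspace (T : H →ₗ[ℂ] H) ν := by
        rw [Module.End.mem_eigenspace_iff]
        exact sub_eq_zero.1 hv
      rw [hbot] at this
      exact Subtype.ext ((Submodule.mem_bot ℂ).1 this)
    obtain ⟨C, _, hC⟩ := L.exists_antilipschitzWith hL
    refine notMem_spectrum_of_bounded_below hT (C := C * ‖cfc f T‖₊ + ‖S‖₊) (fun x => ?_) hνσ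
    have h1 : ‖cfc f T x‖ ≤ C * ‖cfc f T (T x - ν • x)‖ := by
      have := hC.le_mul_dist (⟨cfc f T x, x, rfl⟩ : V) 0
      rw [dist_zero_right, map_zero, dist_zero_right] at this
      rw [map_sub, map_smul, hcomm]
      exact this
    calc ‖x‖ = ‖cfc f T x + S (T x - ν • x)‖ := by rw [hS, add_sub_cancel]
      _ ≤ C * (‖cfc f T‖ * ‖T x - ν • x‖) + ‖S‖ * ‖T x - ν • x‖ := by
          refine (norm_add_le _ _).trans (add_le_add (h1.trans ?_) (le_opNorm _ _))
          gcongr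
          exact le_opNorm _ _
      _ = _ := by push_cast [coe_nnnorm]; ring
  have hTV : ∀ v ∈ V, (T : H →ₗ[ℂ] H) v ∈ V := by
    rintro _ ⟨y, rfl⟩
    exact ⟨T y, hcomm y⟩
  -- These spectral points are all eigenvalues of the restriction of `T` to `V`.
  have hfinσ : (spectrum ℂ T ∩ Metric.ball μ (ε / 3)).Finite := by
    refine (Module.End.finite_hasEigenvalue ((T : H →ₗ[ℂ] H).restrict hTV)).subset ?_
    rintro ν ⟨hνσ, hν⟩
    obtain ⟨v, hv, hv0⟩ := Submodule.exists_mem_ne_zero_of_ne_bot (heig ν hνσ hν)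
    refine Module.End.hasEigenvalue_of_hasEigenvector (x := ⟨v, heigV ν hν hv⟩) ⟨?_, ?_⟩
    · rw [Module.End.mem_eigenspace_iff] at hv ⊢
      exact Subtype.ext hv
    · exact fun h => hv0 (congrArg Subtype.val h)
  have hμb : dist μ μ < ε / 3 := by rw [dist_self]; positivity
  refine hμ.2 ⟨heig μ hμ.1 hμb, Submodule.finiteDimensional_of_le (heigV μ hμb), ?_⟩
  have hsub : (spectrum ℂ T ∩ Metric.ball μ (ε / 3)) \ {μ} ∈ {s : Set ℂ | sᶜ ∈ 𝓝 μ} :=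
    (hfinσ.subset Set.sdiff_subset).isClosed.isOpen_compl.mem_nhds (by simp)
  rw [eventually_nhdsWithin_iff]
  filter_upwards [hsub, Metric.ball_mem_nhds μ (show 0 < ε / 3 by positivity)] with w hw hwb hne hwσ
  exact hw ⟨⟨hwσ, hwb⟩, hne⟩

end Normal

end ContinuousLinearMap

namespace LinearPMap

/-! ### Spectral correspondence between an operator and its resolvent. -/

section ResolventTransform

variable {H : Type*} [NormedAddCommGroup H] [InnerProductSpace ℂ H]
  {A : H →ₗ.[ℂ] H} {z w : ℂ} {R : H →L[ℂ] H}

theorem subScalar_apply (A : H →ₗ.[ℂ] H) (z : ℂ) (y : A.domain) :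
    A.subScalar z y = A y - z • (y : H) := rfl

theorem subScalar_eq (A : H →ₗ.[ℂ] H) (z w : ℂ) (y : A.domain) :
    A.subScalar w y = A.subScalar z y - (w - z) • (y : H) := by
  rw [subScalar_apply, subScalar_apply]
  module

theorem IsResolventAt.map_eigenspace (hR : A.IsResolventAt z R) (hw : w ≠ z) :
    (A.eigenspace w).map A.domain.subtype =
      Module.End.eigenspace (R : H →ₗ[ℂ] H) (w - z)⁻¹ := by
  have hwz : w - z ≠ 0 := sub_ne_zero.2 hw
  ext x
  rw [Module.End.mem_eigenspace_iff, ContinuousLinearMap.coe_coe]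
  constructor
  · rintro ⟨y, hy, rfl⟩
    have h0 : A.subScalar w y = 0 := hy
    rw [subScalar_eq A z, sub_eq_zero] at h0
    have h1 := hR.2 y
    rw [h0, _root_.map_smul] at h1
    rw [eq_inv_smul_iff₀ hwz]
    exact h1
  · intro hx
    obtain ⟨y, hy, hyx⟩ := hR.1 x
    refine ⟨(w - z) • y, ?_, ?_⟩
    · change A.subScalar w ((w - z) • y) = 0
      rw [_root_.map_smul, subScalar_eq A z, hyx, ← hy, hx, smul_inv_smul₀ hwz, sub_self, smul_zero]
    · rw [_root_.map_smul, Submodule.subtype_apply, ← hy, hx, smul_inv_smul₀ hwz]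

theorem IsResolventAt.notMem_spectrum (hR : A.IsResolventAt z R) : z ∉ A.spectrum :=
  fun h => h ⟨R, hR⟩

theorem IsResolventAt.ne_of_mem_essentialSpectrum (hR : A.IsResolventAt z R)
    (h : w ∈ A.essentialSpectrum) : w ≠ z := by
  rintro rfl
  exact hR.notMem_spectrum h.1

/-- The resolvent identity. -/
theorem IsResolventAt.sub_eq {S : H →L[ℂ] H} (hR : A.IsResolventAt z R)
    (hS : A.IsResolventAt w S) : S - R = (w - z) • (R * S) := by
  ext x
  obtain ⟨y, hy, hyx⟩ := hS.1 x
  have h1 := hR.2 y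
  rw [subScalar_eq A w z, hyx, _root_.map_sub, _root_.map_smul, ← hy] at h1
  change S x - R x = (w - z) • R (S x)
  rw [← neg_sub z w, neg_smul]
  nth_rewrite 1 [← h1]
  abel

variable [CompleteSpace H]

/-- Everything rests on the factorization `A - w = (w - z) ((w - z)⁻¹ - R) (A - z)` on the domain of
`A`. -/
theorem IsResolventAt.mem_resolventSet_iff (hR : A.IsResolventAt z R) (hw : w ≠ z) :
    w ∈ A.resolventSet ↔ (w - z)⁻¹ ∉ _root_.spectrum ℂ R := by
  have hwz : w - z ≠ 0 := sub_ne_zero.2 hw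
  rw [_root_.spectrum.mem_iff, not_not]
  have happ : ∀ x, (algebraMap ℂ (H →L[ℂ] H) (w - z)⁻¹ - R) x = (w - z)⁻¹ • x - R x := fun x => by
    simp [Algebra.algebraMap_eq_smul_one]
  constructor
  · rintro ⟨S, hS⟩
    rw [ContinuousLinearMap.isUnit_iff_bijective]
    refine ⟨(injective_iff_map_eq_zero _).2 fun x hx => ?_, fun u => ?_⟩
    · rw [happ, sub_eq_zero] at hx
      obtain ⟨y, hy, hyx⟩ := hR.1 x
      have h0 : A.subScalar w y = 0 := by
        rw [subScalar_eq A z, hyx, ← hy, ← hx, smul_inv_smul₀ hwz, sub_self]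
      have h1 := hS.2 y
      rw [h0, _root_.map_zero] at h1
      rw [← hyx, show y = 0 from Subtype.ext h1.symm, _root_.map_zero]
    · obtain ⟨y, _, hyx⟩ := hS.1 ((w - z) • u)
      refine ⟨A.subScalar z y, ?_⟩
      rw [subScalar_eq A z, sub_eq_iff_eq_add, ← smul_add] at hyx
      rw [happ, hR.2, hyx, inv_smul_smul₀ hwz, add_sub_cancel_right]
  · rintro ⟨⟨B, Q, hBQ, hQB⟩, rfl : B = _⟩
    have hBQ' : ∀ x, (w - z)⁻¹ • Q x - R (Q x) = x := fun x => by
      rw [← happ]; exact congrArg (fun S : H →L[ℂ] H => S x) hBQ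
    have hQB' : ∀ x, Q ((w - z)⁻¹ • x - R x) = x := fun x => by
      rw [← happ]; exact congrArg (fun S : H →L[ℂ] H => S x) hQB
    refine ⟨(w - z)⁻¹ • (R ∘L Q), fun x => ?_, fun y => ?_⟩
    · obtain ⟨y, hy, hyx⟩ := hR.1 (Q x)
      refine ⟨(w - z)⁻¹ • y, ?_, ?_⟩
      · simp [hy]
      · rw [_root_.map_smul, subScalar_eq A z, hyx, ← hy, smul_sub, inv_smul_smul₀ hwz]
        exact hBQ' x
    · have h1 : A.subScalar w y =
          (w - z) • ((w - z)⁻¹ • A.subScalar z y - R (A.subScalar z y)) := by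
        rw [subScalar_eq A z, hR.2, smul_sub, smul_inv_smul₀ hwz]
      rw [h1, _root_.smul_apply, _root_.map_smul, inv_smul_smul₀ hwz,
        ContinuousLinearMap.comp_apply, hQB', hR.2]

theorem IsResolventAt.mem_spectrum_iff (hR : A.IsResolventAt z R) (hw : w ≠ z) :
    w ∈ A.spectrum ↔ (w - z)⁻¹ ∈ _root_.spectrum ℂ R := by
  rw [spectrum, Set.mem_compl_iff, hR.mem_resolventSet_iff hw, not_not]

/-- The maps `v ↦ (v - z)⁻¹` and `ν ↦ z + ν⁻¹` are mutually inverse and continuous away from their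
poles, so they exchange punctured neighbourhoods. -/
theorem IsResolventAt.eventually_notMem_spectrum_iff (hR : A.IsResolventAt z R) (hw : w ≠ z) :
    (∀ᶠ v in 𝓝[≠] w, v ∉ A.spectrum) ↔
      ∀ᶠ ν in 𝓝[≠] (w - z)⁻¹, ν ∉ _root_.spectrum ℂ R := by
  have hwz : w - z ≠ 0 := sub_ne_zero.2 hw
  constructor
  · intro h
    have ht : Tendsto (fun ν : ℂ => z + ν⁻¹) (𝓝[≠] (w - z)⁻¹) (𝓝[≠] w) := by
      refine tendsto_nhdsWithin_iff.2 ⟨?_, ?_⟩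
      · have : ContinuousAt (fun ν : ℂ => z + ν⁻¹) (w - z)⁻¹ :=
          continuousAt_const.add (continuousAt_inv₀ (inv_ne_zero hwz))
        have h2 := this.tendsto
        simp only [inv_inv, add_sub_cancel] at h2
        exact h2.mono_left nhdsWithin_le_nhds
      · filter_upwards [self_mem_nhdsWithin] with ν hν h
        refine hν ?_
        rw [Set.mem_singleton_iff, ← Set.mem_singleton_iff.1 h, add_sub_cancel_left, inv_inv]
    filter_upwards [ht.eventually h,
      nhdsWithin_le_nhds (isOpen_ne.mem_nhds (inv_ne_zero hwz))] with ν hν hν0 hνσ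
    refine hν ((hR.mem_spectrum_iff ?_).2 ?_)
    · simpa using hν0
    · simpa using hνσ
  · intro h
    have ht : Tendsto (fun v : ℂ => (v - z)⁻¹) (𝓝[≠] w) (𝓝[≠] (w - z)⁻¹) := by
      refine tendsto_nhdsWithin_iff.2 ⟨?_, ?_⟩
      · have : ContinuousAt (fun v : ℂ => (v - z)⁻¹) w :=
          (continuousAt_id.sub continuousAt_const).inv₀ hwz
        exact this.tendsto.mono_left nhdsWithin_le_nhds
      · filter_upwards [self_mem_nhdsWithin] with v hv h
        exact hv (sub_left_injective (inv_injective h))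
    filter_upwards [ht.eventually h] with v hv hvσ
    refine hv ((hR.mem_spectrum_iff ?_).1 hvσ)
    rintro rfl
    exact hR.notMem_spectrum hvσ

/-- The essential spectrum of an operator corresponds to that of its resolvent. -/
theorem IsResolventAt.mem_essentialSpectrum_iff (hR : A.IsResolventAt z R) (hw : w ≠ z) :
    w ∈ A.essentialSpectrum ↔ (w - z)⁻¹ ∈ R.essentialSpectrum := by
  have hiso : (∃ ε : ℝ, 0 < ε ∧ ∀ v ∈ A.spectrum, dist v w < ε → v = w) ↔
      ∀ᶠ v in 𝓝[≠] w, v ∉ A.spectrum := by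
    rw [eventually_nhdsWithin_iff, Metric.eventually_nhds_iff]
    refine exists_congr fun ε => and_congr_right fun _ => ⟨fun h v hv hne hσ => hne (h v hσ hv),
      fun h v hσ hv => ?_⟩
    by_contra hne
    exact h hv hne hσ
  have hbot : A.eigenspace w ≠ ⊥ ↔
      Module.End.eigenspace (R : H →ₗ[ℂ] H) (w - z)⁻¹ ≠ ⊥ := by
    rw [← hR.map_eigenspace hw, Ne, Ne, not_iff_not,
      ← (Submodule.map_injective_of_injective A.domain.injective_subtype).eq_iff, Submodule.map_bot]
  have hfin : FiniteDimensional ℂ (A.eigenspace w) ↔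
      FiniteDimensional ℂ (Module.End.eigenspace (R : H →ₗ[ℂ] H) (w - z)⁻¹) := by
    rw [← hR.map_eigenspace hw]
    let e := Submodule.equivMapOfInjective A.domain.subtype A.domain.injective_subtype
      (A.eigenspace w)
    exact ⟨fun _ => e.finiteDimensional, fun _ => e.symm.finiteDimensional⟩
  rw [essentialSpectrum, Set.mem_sdiff, discreteSpectrum, Set.mem_ofPred_eq,
    ContinuousLinearMap.essentialSpectrum, Set.mem_ofPred_eq, hiso,
    hR.eventually_notMem_spectrum_iff hw, hR.mem_spectrum_iff hw, hbot, hfin]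

/-- The adjoint of the resolvent of a self-adjoint operator at `z` is the resolvent at the
conjugate of `z`. -/
theorem IsResolventAt.adjoint (hA : IsSelfAdjoint A) (hR : A.IsResolventAt z R) :
    A.IsResolventAt (starRingEnd ℂ z) R.adjoint := by
  have hdense := hA.dense_domain
  have hAA : A.adjoint = A := isSelfAdjoint_def.1 hA
  have hsymm : A.IsFormalAdjoint A := by
    have := adjoint_isFormalAdjoint (T := A) hdense
    rwa [hAA] at this
  refine ⟨fun x => ?_, fun y => ?_⟩
  -- This places `R* x` in the domain of `A* = A` and identifies its image.
  · have key : ∀ y : A.domain, inner ℂ (x + starRingEnd ℂ z • R.adjoint x) (y : H) =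
        inner ℂ (R.adjoint x) (A y) := by
      intro y
      have h1 : inner ℂ (R.adjoint x) (A.subScalar z y) = inner ℂ x (y : H) := by
        rw [ContinuousLinearMap.adjoint_inner_left, hR.2]
      rw [subScalar_apply, inner_sub_right, inner_smul_right, sub_eq_iff_eq_add] at h1
      rw [h1, inner_add_left, inner_smul_left, Complex.conj_conj]
    have hmem : R.adjoint x ∈ A.adjoint.domain := mem_adjoint_domain_of_exists _ ⟨_, key⟩
    have happ := adjoint_apply_eq hdense ⟨_, hmem⟩ key
    have hex : ∃ y : A.domain, (y : H) = R.adjoint x ∧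
        A y = x + starRingEnd ℂ z • R.adjoint x := by
      rw [← hAA]
      exact ⟨⟨_, hmem⟩, rfl, happ⟩
    obtain ⟨y, hy, hAy⟩ := hex
    refine ⟨y, hy.symm, ?_⟩
    rw [subScalar_apply, hAy, hy, add_sub_cancel_right]
  · refine ext_inner_right ℂ fun u => ?_
    obtain ⟨v, hv, hvu⟩ := hR.1 u
    rw [ContinuousLinearMap.adjoint_inner_left, hv, subScalar_apply, inner_sub_left, hsymm y v,
      inner_smul_left, Complex.conj_conj, ← inner_smul_right, ← inner_sub_right, ← hvu]
    rfl

/-- The resolvent of a self-adjoint operator is normal. -/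
theorem IsResolventAt.isStarNormal (hA : IsSelfAdjoint A) (hR : A.IsResolventAt z R) :
    IsStarNormal R := by
  have hS := hR.adjoint hA
  refine ⟨?_⟩
  rw [ContinuousLinearMap.star_eq_adjoint]
  by_cases hz : starRingEnd ℂ z = z
  · rw [hz] at hS
    rw [hS.unique hR]
  -- For nonreal `z`, the resolvent identity read in both orders gives `R R* = R* R`.
  · have h1 := hR.sub_eq hS
    have h2 := hS.sub_eq hR
    rw [← neg_sub, h1, ← neg_sub _ z, neg_smul, neg_inj] at h2
    exact (smul_right_injective _ (sub_ne_zero.2 hz) h2).symm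

end ResolventTransform

end LinearPMap

namespace ContinuousLinearMap

/-! ### From almost unitary maps to almost intertwining ones. -/

section Intertwining

variable {H : Type*} [NormedAddCommGroup H] [InnerProductSpace ℂ H]
  {K : Type*} [NormedAddCommGroup K] [InnerProductSpace ℂ K]

theorem norm_le_of_norm_comp_sub_id_le {X : H →L[ℂ] K} {Y : K →L[ℂ] H} {C : ℝ}
    (hY : ‖Y‖ ≤ C) (hYX : ‖Y ∘L X - ContinuousLinearMap.id ℂ H‖ ≤ 1 / 2) (x : H) :
    ‖x‖ ≤ 2 * C * ‖X x‖ := by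
  have h1 : x = Y (X x) - (Y ∘L X - ContinuousLinearMap.id ℂ H) x := by simp
  have h2 : ‖x‖ ≤ C * ‖X x‖ + 1 / 2 * ‖x‖ := by
    conv_lhs => rw [h1]
    exact (norm_sub_le _ _).trans (add_le_add (le_of_opNorm_le _ hY _) (le_of_opNorm_le _ hYX _))
  linarith

/-- If `Y` almost inverts `X` on the left of `K` and `Y S X` is close to `T`, then `X` almost
intertwines `T` and `S`. -/
theorem norm_comp_sub_comp_le {X : H →L[ℂ] K} {Y : K →L[ℂ] H} {T : H →L[ℂ] H} {S : K →L[ℂ] K}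
    {C : ℝ} (hX : ‖X‖ ≤ C) (hXY : ‖X ∘L Y - ContinuousLinearMap.id ℂ K‖ ≤ 1 / 2) :
    ‖X ∘L T - S ∘L X‖ ≤ C * ‖Y ∘L S ∘L X - T‖ +
      ‖X ∘L Y - ContinuousLinearMap.id ℂ K‖ * (2 * (C * (‖T‖ + ‖Y ∘L S ∘L X - T‖))) := by
  set D := Y ∘L S ∘L X - T with hD
  set E := X ∘L Y - ContinuousLinearMap.id ℂ K with hE
  have h1 : S ∘L X = X ∘L (T + D) - E ∘L (S ∘L X) := by
    ext x; simp [hD, hE]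
  have h2 : X ∘L T - S ∘L X = E ∘L (S ∘L X) - X ∘L D := by
    ext x; simp [hD, hE]
  -- No bound on `‖S‖` is given: `S ∘L X` recurs in `h1` with a factor of norm at most `1/2`, which
  -- is absorbed on the left.
  have h3 : ‖S ∘L X‖ ≤ 2 * (C * (‖T‖ + ‖D‖)) := by
    have : ‖S ∘L X‖ ≤ C * (‖T‖ + ‖D‖) + 1 / 2 * ‖S ∘L X‖ := by
      conv_lhs => rw [h1]
      refine (norm_sub_le _ _).trans (add_le_add ?_ ?_)
      · refine (opNorm_comp_le _ _).trans ?_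
        gcongr
        · exact (norm_nonneg X).trans hX
        · exact norm_add_le _ _
      · refine (opNorm_comp_le _ _).trans ?_
        gcongr
    linarith
  rw [h2, add_comm]
  refine (norm_sub_le _ _).trans (add_le_add ?_ ?_)
  · refine (opNorm_comp_le _ _).trans ?_
    gcongr
  · refine (opNorm_comp_le _ _).trans ?_
    gcongr

theorem exists_mem_essentialSpectrum_of_intertwining [CompleteSpace H] [CompleteSpace K]
    {X : H →L[ℂ] K} {T : H →L[ℂ] H} {S : K →L[ℂ] K} (hT : IsStarNormal T) (hS : IsStarNormal S)
    {C m δ r : ℝ} (hC : 0 < C) (hm : 0 < m) (hX : ‖X‖ ≤ C) (hXm : ∀ x, ‖x‖ ≤ m * ‖X x‖)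
    (hXT : ‖X ∘L T - S ∘L X‖ ≤ δ) (hr : δ * m < r) {μ : ℂ} (hμ : μ ∈ T.essentialSpectrum) :
    ∃ ν ∈ S.essentialSpectrum, dist ν μ ≤ r := by
  have hδ : 0 ≤ δ := (norm_nonneg _).trans hXT
  -- With this quality, the transported quasimodes have constant at most `(r + δ * m) / 2`, the
  -- midpoint between `δ * m` and `r`.
  have hε : 0 < (r - δ * m) / (2 * C * m) := div_pos (sub_pos.2 hr) (by positivity)
  have hq := (hasQuasimodes_of_mem_essentialSpectrum hT hμ hε).map hε.le hδ hXm hXT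
  refine hq.exists_mem_essentialSpectrum hS ?_ ((by positivity : 0 ≤ δ * m).trans_lt hr)
  calc (‖X‖ * ((r - δ * m) / (2 * C * m)) + δ) * m
      ≤ (C * ((r - δ * m) / (2 * C * m)) + δ) * m := by gcongr
    _ = (r + δ * m) / 2 := by field_simp; ring
    _ < r := by linarith

end Intertwining

end ContinuousLinearMap

/-! ### Two-sided closeness of the essential spectra. -/

namespace LinearPMap

/-- The essential spectra of normal operators that converge in the generalized norm sense converge
in the Hausdorff sense. -/
theorem AsymptoticallyUnitary.eventually_essentialSpectrum_near
    {H : Type*} [NormedAddCommGroup H] [InnerProductSpace ℂ H] [CompleteSpace H]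
    {K : ℕ → Type*} [∀ n, NormedAddCommGroup (K n)] [∀ n, InnerProductSpace ℂ (K n)]
    [∀ n, CompleteSpace (K n)] {J : ∀ n, H →L[ℂ] K n} (hJ : AsymptoticallyUnitary J)
    {R : H →L[ℂ] H} {S : ∀ n, K n →L[ℂ] K n} (hR : IsStarNormal R) (hS : ∀ n, IsStarNormal (S n))
    (h : Tendsto (fun n => ‖(J n).adjoint ∘L S n ∘L J n - R‖) atTop (𝓝 0)) {r : ℝ} (hr : 0 < r) :
    ∀ᶠ n in atTop, (∀ μ ∈ R.essentialSpectrum, ∃ ν ∈ (S n).essentialSpectrum, dist ν μ ≤ r) ∧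
      ∀ ν ∈ (S n).essentialSpectrum, ∃ μ ∈ R.essentialSpectrum, dist μ ν ≤ r := by
  obtain ⟨⟨C, hC, hJC⟩, h1, h2⟩ := hJ
  have hlim : Tendsto (fun n => (C * ‖(J n).adjoint ∘L S n ∘L J n - R‖ +
      ‖J n ∘L (J n).adjoint - ContinuousLinearMap.id ℂ (K n)‖ *
        (2 * (C * (‖R‖ + ‖(J n).adjoint ∘L S n ∘L J n - R‖)))) * (2 * C)) atTop (𝓝 0) := by
    have := ((h.const_mul C).add
      (h2.mul (((h.const_add ‖R‖).const_mul C).const_mul 2))).mul_const (2 * C)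
    simpa using this
  filter_upwards [hlim.eventually (gt_mem_nhds hr),
    h1.eventually (ge_mem_nhds (show (0 : ℝ) < 1 / 2 by norm_num)),
    h2.eventually (ge_mem_nhds (show (0 : ℝ) < 1 / 2 by norm_num))] with n hn h1n h2n
  have hJa : ‖(J n).adjoint‖ ≤ C := by
    rw [LinearIsometryEquiv.norm_map]; exact hJC n
  refine ⟨fun μ hμ => ?_, fun ν hν => ?_⟩
  · exact ContinuousLinearMap.exists_mem_essentialSpectrum_of_intertwining hR (hS n) hC
      (by positivity) (hJC n) (ContinuousLinearMap.norm_le_of_norm_comp_sub_id_le hJa h1n)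
      (ContinuousLinearMap.norm_comp_sub_comp_le (hJC n) h2n) hn hμ
  -- Here `Jₙ*` transports quasimodes back. Its intertwining error is the adjoint of the error of
  -- `Jₙ` for `R*` and `Sₙ*`, so the same bound applies.
  · refine ContinuousLinearMap.exists_mem_essentialSpectrum_of_intertwining (hS n) hR hC
      (by positivity) hJa (ContinuousLinearMap.norm_le_of_norm_comp_sub_id_le (hJC n) h2n)
      ?_ hn hν
    have hadj := ContinuousLinearMap.norm_comp_sub_comp_le (T := R.adjoint) (S := (S n).adjoint)
      (hJC n) h2n
    have e1 : (J n).adjoint ∘L (S n).adjoint ∘L J n - R.adjoint =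
        ((J n).adjoint ∘L S n ∘L J n - R).adjoint := by
      simp [ContinuousLinearMap.adjoint_comp, ContinuousLinearMap.comp_assoc]
    have e2 : J n ∘L R.adjoint - (S n).adjoint ∘L J n =
        (R ∘L (J n).adjoint - (J n).adjoint ∘L S n).adjoint := by
      simp [ContinuousLinearMap.adjoint_comp]
    rw [e1, e2, LinearIsometryEquiv.norm_map, LinearIsometryEquiv.norm_map,
      LinearIsometryEquiv.norm_map] at hadj
    rwa [norm_sub_rev]

end LinearPMap

/-! ### Limits of sets and the conclusion. -/

theorem mem_setLimit_of_forall_eventually {S : ℕ → Set ℂ} {z : ℂ}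
    (h : ∀ ε : ℝ, 0 < ε → ∀ᶠ n in atTop, ∃ x ∈ S n, dist z x < ε) : z ∈ setLimit S := by
  -- Almost nearest points give one sequence that serves every `ε`; the value for empty `S n` is
  -- irrelevant.
  have hch : ∀ n, ∃ x, (S n).Nonempty →
      x ∈ S n ∧ dist z x < Metric.infDist z (S n) + 1 / ((n : ℝ) + 1) := by
    intro n
    by_cases hn : (S n).Nonempty
    · obtain ⟨x, hx, hd⟩ := (Metric.infDist_lt_iff hn).1
        (lt_add_of_pos_right (Metric.infDist z (S n)) (Nat.one_div_pos_of_nat (n := n)))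
      exact ⟨x, fun _ => ⟨hx, hd⟩⟩
    · exact ⟨0, fun h => absurd h hn⟩
  choose l hl using hch
  refine ⟨l, ?_, ?_⟩
  · filter_upwards [h 1 one_pos] with n hn
    obtain ⟨x, hx, -⟩ := hn
    exact (hl n ⟨x, hx⟩).1
  · rw [Metric.tendsto_nhds]
    intro ε hε
    have ht : ∀ᶠ n : ℕ in atTop, 1 / ((n : ℝ) + 1) < ε / 2 :=
      tendsto_one_div_add_atTop_nhds_zero_nat.eventually (gt_mem_nhds (half_pos hε))
    filter_upwards [h (ε / 2) (half_pos hε), ht] with n hn hn'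
    obtain ⟨x, hx, hxd⟩ := hn
    have h1 := (hl n ⟨x, hx⟩).2
    have h2 := Metric.infDist_le_dist_of_mem (x := z) hx
    rw [dist_comm]
    linarith

theorem mainTheorem3
    {H : Type*} [NormedAddCommGroup H] [InnerProductSpace ℂ H] [CompleteSpace H]
    [TopologicalSpace.SeparableSpace H]
    {K : ℕ → Type*} [∀ n, NormedAddCommGroup (K n)] [∀ n, InnerProductSpace ℂ (K n)]
    [∀ n, CompleteSpace (K n)] [∀ n, TopologicalSpace.SeparableSpace (K n)]
    (J : ∀ n, H →L[ℂ] K n)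
    (A : H →ₗ.[ℂ] H) (An : ∀ n, K n →ₗ.[ℂ] K n)
    (hA : IsSelfAdjoint A) (hAn : ∀ n, IsSelfAdjoint (An n))
    (hconv : LinearPMap.GenNormResolventConv J An A) :
    A.essentialSpectrum = setLimit (fun n => (An n).essentialSpectrum) := by
  obtain ⟨hJ, z, hz, hlim⟩ := hconv
  have hzA : z ∈ A.resolventSet := by
    by_contra h
    exact hz (subset_closure (Or.inl h))
  have hzn : ∀ n, z ∈ (An n).resolventSet := by
    intro n
    by_contra h
    exact hz (subset_closure (Or.inr (Set.mem_iUnion.2 ⟨n, h⟩)))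
  have hR := LinearPMap.isResolventAt_resolvent hzA
  have hRn := fun n => LinearPMap.isResolventAt_resolvent (hzn n)
  have hnear := fun (r : ℝ) (hr : 0 < r) => hJ.eventually_essentialSpectrum_near
    (hR.isStarNormal hA) (fun n => (hRn n).isStarNormal (hAn n)) hlim hr
  ext w
  constructor
  · intro hw
    have hwz := hR.ne_of_mem_essentialSpectrum hw
    have hwz0 : w - z ≠ 0 := sub_ne_zero.2 hwz
    have hμ := (hR.mem_essentialSpectrum_iff hwz).1 hw
    refine mem_setLimit_of_forall_eventually fun ε hε => ?_
    have hcont : ContinuousAt (fun ν : ℂ => z + ν⁻¹) (w - z)⁻¹ :=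
      continuousAt_const.add (continuousAt_inv₀ (inv_ne_zero hwz0))
    -- The condition `ν ≠ 0` excludes the one point of the resolvent's spectrum that corresponds to
    -- no `w`.
    have hev : ∀ᶠ ν in 𝓝 (w - z)⁻¹, ν ≠ 0 ∧ dist w (z + ν⁻¹) < ε := by
      refine (eventually_ne_nhds (inv_ne_zero hwz0)).and ?_
      have := Metric.tendsto_nhds.1 hcont ε hε
      simpa only [inv_inv, add_sub_cancel, dist_comm w] using this
    obtain ⟨r, hr, hball⟩ := Metric.nhds_basis_closedBall.eventually_iff.1 hev
    filter_upwards [hnear r hr] with n hn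
    obtain ⟨ν, hν, hνr⟩ := hn.1 _ hμ
    obtain ⟨hν0, hd⟩ := hball hνr
    refine ⟨z + ν⁻¹, ((hRn n).mem_essentialSpectrum_iff ?_).2 ?_, hd⟩
    · simpa using hν0
    · simpa using hν
  · rintro ⟨l, hl, hlw⟩
    have hwz : w ≠ z := by
      rintro rfl
      refine hz (isClosed_closure.mem_of_tendsto hlw ?_)
      filter_upwards [hl] with n hn
      exact subset_closure (Or.inr (Set.mem_iUnion.2 ⟨n, hn.1⟩))
    -- Since the essential spectrum of `R` is closed, approximating `(w - z)⁻¹` by its points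
    -- suffices.
    rw [hR.mem_essentialSpectrum_iff hwz,
      ← (ContinuousLinearMap.isClosed_essentialSpectrum _).closure_eq, Metric.mem_closure_iff]
    intro ε hε
    have hμ : Tendsto (fun n => (l n - z)⁻¹) atTop (𝓝 (w - z)⁻¹) :=
      (hlw.sub_const z).inv₀ (sub_ne_zero.2 hwz)
    obtain ⟨n, hn, hln, hd⟩ := ((hnear (ε / 2) (half_pos hε)).and
      (hl.and (Metric.tendsto_nhds.1 hμ (ε / 2) (half_pos hε)))).exists
    obtain ⟨ν, hν, hνd⟩ := hn.2 _
      (((hRn n).mem_essentialSpectrum_iff ((hRn n).ne_of_mem_essentialSpectrum hln)).1 hln)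
    refine ⟨ν, hν, ?_⟩
    have := dist_triangle_right (w - z)⁻¹ ν (l n - z)⁻¹
    rw [dist_comm] at hd
    linarith

end
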